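/- Let $R$ be a commutative ring equipped with a (nonarchimedean) submultiplicative norm $|\cdot|$, i.e. a function $|\cdot|:R\to[0,\infty)$ with $|a-b|\le\max\{|a|,|b|\}$, $|a|=0$ if and only if $a=0$, $|1|\le 1$ and $|ab|\le|a||b|$. Equip $R[T]$ with the Gauss norm $|\sum_i x_iT^i|=\max_i|x_i|$. For a ring $A$ with a submultiplicative norm, let $\mathcal M(A)$ be the set of multiplicative nonarchimedean seminorms $\alpha$ on $A$ (so $\alpha(0)=0$, $\alpha(a-b)\le\max\{\alpha(a),\alpha(b)\}$, $\alpha(1)\le 1$, $\alpha(ab)=\alpha(a)\alpha(b)$) that are dominated by the norm of $A$; here a seminorm $\alpha$ dominates a seminorm $\alpha'$, written $\alpha\ge\alpha'$, if there is $c>0$ with $\alpha'(a)\le c\,\alpha(a)$ for all $a$. Let $\mu:\mathcal M(R[T])\to\mathcal M(R)$ be restriction along $R\to R[T]$. For $\beta\in\mathcal M(R[T])$ and $t\in[0,1]$ let $H(\beta,t)\in\mathcal M(R[T])$ be given by $$H(\beta,t)(f)=\max_i\Big\{t^i\,\beta\Big(\tfrac1{i!}\tfrac{d^i}{dT^i}f\Big)\Big\},$$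 where $\tfrac1{i!}\tfrac{d^i}{dT^i}$ denotes the $i$-th divided derivative $T^n\mapsto\binom{n}{i}T^{n-i}$, and let $r(\beta)$ be the greatest $s\in[0,1]$ with $H(\beta,s)=\beta$. (1) For all $\beta,\gamma\in\mathcal M(R[T])$ with $\mu(\beta)=\mu(\gamma)$ and $\beta\ge\gamma$, one has $\beta=H(\gamma,r(\beta))$; moreover $r(\beta)\ge r(\gamma)$, with equality if and only if $\beta=\gamma$. (2) For every $\alpha\in\mathcal M(R)$, the fibre $\mu^{-1}(\alpha)$ is a tree under domination: domination is a partial order on it, it has a largest element, and any two elements of it dominating a common third element of it are comparable. -/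

import Mathlib

namespace GelfandTree

open Polynomial

/-- A (nonarchimedean) submultiplicative norm on a commutative ring `A`. The condition
`N 1 ≤ 1` allows the zero ring. -/
structure SubmulNorm (A : Type*) [CommRing A] extends NonarchAddGroupNorm A where
  map_one_le' : toFun 1 ≤ 1
  map_mul_le' : ∀ a b, toFun (a * b) ≤ toFun a * toFun b

namespace SubmulNorm

variable {A : Type*} [CommRing A]

instance : FunLike (SubmulNorm A) A ℝ where
  coe N := N.toFun
  coe_injective N N' h := by
    rcases N with ⟨⟨⟨⟨N, _⟩, _, _⟩, _⟩, _, _⟩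
    rcases N' with ⟨⟨⟨⟨N', _⟩, _, _⟩, _⟩, _, _⟩
    congr

instance : NonarchAddGroupNormClass (SubmulNorm A) A where
  map_add_le_max N := N.add_le_max'
  map_zero N := N.map_zero'
  map_neg_eq_map' N := N.neg'
  eq_zero_of_map_eq_zero N := N.eq_zero_of_map_eq_zero' _

instance : ZeroHomClass (SubmulNorm A) A ℝ where
  map_zero N := N.map_zero'

theorem nonneg (N : SubmulNorm A) (a : A) : 0 ≤ N a := by
  have h := N.add_le_max' a (-a)
  rw [N.neg', add_neg_cancel, N.map_zero', max_self] at h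
  exact h

instance : NonnegHomClass (SubmulNorm A) A ℝ where
  apply_nonneg N := N.nonneg

end SubmulNorm

/-- The seminorm `α` dominates the seminorm `α'`: there is `c > 0` with `α' ≤ c α`. -/
def Dominates {G F F' : Type*} [AddGroup G]
    [FunLike F G ℝ] [NonarchAddGroupSeminormClass F G]
    [FunLike F' G ℝ] [NonarchAddGroupSeminormClass F' G] (α : F) (α' : F') : Prop :=
  ∃ c : ℝ, 0 < c ∧ ∀ g : G, α' g ≤ c * α g

/-- The Gel'fand spectrum `ℳ(A)` of `A` with respect to the submultiplicative norm `N`: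
the set of multiplicative nonarchimedean seminorms on `A` which are dominated by `N`. -/
structure GelfandSpectrum {A : Type*} [CommRing A] (N : SubmulNorm A)
    extends NonarchAddGroupSeminorm A where
  map_one_le' : toFun 1 ≤ 1
  map_mul' : ∀ a b, toFun (a * b) = toFun a * toFun b
  dominated' : Dominates N toNonarchAddGroupSeminorm

namespace GelfandSpectrum

variable {A : Type*} [CommRing A] {N : SubmulNorm A}

instance : FunLike (GelfandSpectrum N) A ℝ where
  coe α := α.toFun
  coe_injective α β h := by
    rcases α with ⟨⟨⟨α, _⟩, _, _⟩, _, _, _⟩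
    rcases β with ⟨⟨⟨β, _⟩, _, _⟩, _, _, _⟩
    congr

@[ext]
theorem ext {α β : GelfandSpectrum N} (h : ∀ a, α a = β a) : α = β := DFunLike.ext _ _ h

instance : NonarchAddGroupSeminormClass (GelfandSpectrum N) A where
  map_add_le_max α := α.add_le_max'
  map_zero α := α.map_zero'
  map_neg_eq_map' α := α.neg'

instance : ZeroHomClass (GelfandSpectrum N) A ℝ where
  map_zero α := α.map_zero'

instance : MulHomClass (GelfandSpectrum N) A ℝ where
  map_mul α := α.map_mul'

theorem nonneg (α : GelfandSpectrum N) (a : A) : 0 ≤ α a := by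
  have h := α.add_le_max' a (-a)
  rw [α.neg', add_neg_cancel, α.map_zero', max_self] at h
  exact h

instance : NonnegHomClass (GelfandSpectrum N) A ℝ where
  apply_nonneg α := α.nonneg

theorem isNonarchimedean (α : GelfandSpectrum N) : IsNonarchimedean α := α.add_le_max'

theorem map_one_le (α : GelfandSpectrum N) : α 1 ≤ 1 := α.map_one_le'

theorem dominated (α : GelfandSpectrum N) : ∃ c : ℝ, 0 < c ∧ ∀ a, α a ≤ c * N a := α.dominated'

end GelfandSpectrum

/-! ### The Gauss norm on `R[T]` -/

variable {R : Type*} [CommRing R]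

theorem isNonarchimedean_coe (N : SubmulNorm R) : IsNonarchimedean N := N.add_le_max'

theorem sum_le_of_forall_le {F A : Type*} [CommRing A] [FunLike F A ℝ]
    [NonarchAddGroupSeminormClass F A] (v : F) {ι : Type*} (s : Finset ι) (g : ι → A) {B : ℝ}
    (hB : 0 ≤ B) (h : ∀ i ∈ s, v (g i) ≤ B) : v (∑ i ∈ s, g i) ≤ B := by
  classical
  induction s using Finset.induction_on with
  | empty => simpa [NonarchAddGroupSeminormClass.map_zero v] using hB
  | insert i s hi ih =>
    rw [Finset.sum_insert hi]
    refine (map_add_le_max v _ _).trans (max_le (h i (Finset.mem_insert_self _ _)) (ih ?_))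
    exact fun j hj => h j (Finset.mem_insert_of_mem hj)

theorem nsmul_le (N : SubmulNorm R) (n : ℕ) (a : R) : N (n * a) ≤ N a := by
  have h := sum_le_of_forall_le N (Finset.range n) (fun _ => a) (N.nonneg a) (fun _ _ => le_rfl)
  simpa using h

theorem gaussNorm_le_of_forall {F : Type*} [FunLike F R ℝ] (v : F) (f : R[X]) {B : ℝ}
    (hB : 0 ≤ B) (h : ∀ i, v (f.coeff i) ≤ B) : f.gaussNorm v 1 ≤ B := by
  unfold Polynomial.gaussNorm
  split_ifs with hf
  · exact Finset.sup'_le hf _ fun i _ => by simpa using h i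
  · exact hB

theorem coeff_le_gaussNorm (N : SubmulNorm R) (f : R[X]) (i : ℕ) :
    N (f.coeff i) ≤ f.gaussNorm N 1 := by
  simpa using Polynomial.le_gaussNorm N f zero_le_one i

/-- The Gauss norm `∑ xᵢ Tⁱ ↦ maxᵢ |xᵢ|` on `R[T]`. -/
noncomputable def gauss (N : SubmulNorm R) : SubmulNorm R[X] where
  toFun f := f.gaussNorm N 1
  map_zero' := Polynomial.gaussNorm_zero N 1
  add_le_max' := Polynomial.isNonarchimedean_gaussNorm N (isNonarchimedean_coe N) zero_le_one
  neg' f := by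
    change (-f).gaussNorm N 1 = f.gaussNorm N 1
    refine le_antisymm
      (gaussNorm_le_of_forall N _ (Polynomial.gaussNorm_nonneg N f zero_le_one) fun i => ?_)
      (gaussNorm_le_of_forall N _ (Polynomial.gaussNorm_nonneg N (-f) zero_le_one) fun i => ?_)
    · rw [coeff_neg, map_neg_eq_map]
      exact coeff_le_gaussNorm N f i
    · rw [← map_neg_eq_map, ← coeff_neg]
      exact coeff_le_gaussNorm N (-f) i
  eq_zero_of_map_eq_zero' f h :=
    (Polynomial.gaussNorm_eq_zero_iff N f
      (fun _ hx => N.eq_zero_of_map_eq_zero' _ hx) one_pos).1 h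
  map_one_le' := by
    change (1 : R[X]).gaussNorm N 1 ≤ 1
    rw [← C_1, Polynomial.gaussNorm_C]
    exact N.map_one_le'
  map_mul_le' f g := by
    have hf := Polynomial.gaussNorm_nonneg N f zero_le_one
    have hg := Polynomial.gaussNorm_nonneg N g zero_le_one
    refine gaussNorm_le_of_forall N _ (mul_nonneg hf hg) fun i => ?_
    rw [coeff_mul]
    refine sum_le_of_forall_le N _ _ (mul_nonneg hf hg) fun p _ => ?_
    exact (N.map_mul_le' _ _).trans (mul_le_mul (coeff_le_gaussNorm N f _)
      (coeff_le_gaussNorm N g _) (N.nonneg _) hf)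

theorem gauss_apply (N : SubmulNorm R) (f : R[X]) : gauss N f = f.gaussNorm N 1 := rfl

theorem gauss_hasseDeriv_le (N : SubmulNorm R) (i : ℕ) (f : R[X]) :
    gauss N (hasseDeriv i f) ≤ gauss N f := by
  refine gaussNorm_le_of_forall N _ ((gauss N).nonneg f) fun n => ?_
  rw [hasseDeriv_coeff]
  exact (nsmul_le N _ _).trans (coeff_le_gaussNorm N f _)

/-- The projection `μ : ℳ(R[T]) → ℳ(R)`, restriction along `R → R[T]`. -/
noncomputable def mu {N : SubmulNorm R} (β : GelfandSpectrum (gauss N)) : GelfandSpectrum N where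
  toFun a := β (C a)
  map_zero' := by simp
  add_le_max' a b := by rw [C_add]; exact β.isNonarchimedean _ _
  neg' a := by rw [C_neg, map_neg_eq_map]
  map_one_le' := by rw [C_1]; exact β.map_one_le
  map_mul' a b := by rw [C_mul, map_mul]
  dominated' := by
    obtain ⟨c, hc, h⟩ := β.dominated
    refine ⟨c, hc, fun a => ?_⟩
    have := h (C a)
    rwa [gauss_apply, Polynomial.gaussNorm_C] at this

/-! ### The homotopy `H` -/

/-- The key computation for multiplicativity: a weighted maximum of a multiplicative seminorm
is multiplicative for convolution of sequences. -/
theorem isGreatest_conv {A : Type*} [CommRing A] {N : SubmulNorm A} (β : GelfandSpectrum N)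
    {t : ℝ} (ht : 0 ≤ t) {a b c : ℕ → A}
    (hc : ∀ i, c i = ∑ p ∈ Finset.HasAntidiagonal.antidiagonal i, a p.1 * b p.2) {Ma Mb Mc : ℝ}
    (hMa : IsGreatest (Set.range fun i => t ^ i * β (a i)) Ma)
    (hMb : IsGreatest (Set.range fun i => t ^ i * β (b i)) Mb)
    (hMc : IsGreatest (Set.range fun i => t ^ i * β (c i)) Mc) : Mc = Ma * Mb := by
  classical
  have ha0 : ∀ i, 0 ≤ t ^ i * β (a i) := fun i => mul_nonneg (pow_nonneg ht i) (β.nonneg _)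
  have hb0 : ∀ i, 0 ≤ t ^ i * β (b i) := fun i => mul_nonneg (pow_nonneg ht i) (β.nonneg _)
  have ha : ∀ i, t ^ i * β (a i) ≤ Ma := fun i => hMa.2 ⟨i, rfl⟩
  have hb : ∀ i, t ^ i * β (b i) ≤ Mb := fun i => hMb.2 ⟨i, rfl⟩
  have hMa0 : 0 ≤ Ma := (ha0 0).trans (ha 0)
  have hMb0 : 0 ≤ Mb := (hb0 0).trans (hb 0)
  have hterm : ∀ p : ℕ × ℕ, t ^ (p.1 + p.2) * β (a p.1 * b p.2)
      = (t ^ p.1 * β (a p.1)) * (t ^ p.2 * β (b p.2)) := fun p => by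
    rw [map_mul, pow_add]; ring
  have hle : Mc ≤ Ma * Mb := by
    obtain ⟨i, hi⟩ := hMc.1
    dsimp only at hi
    rw [← hi, hc]
    rcases (pow_nonneg ht i).eq_or_lt with h0 | hpos
    · rw [← h0, zero_mul]; exact mul_nonneg hMa0 hMb0
    rw [mul_comm, ← le_div_iff₀ hpos]
    refine sum_le_of_forall_le β _ _ (div_nonneg (mul_nonneg hMa0 hMb0) hpos.le) fun p hp => ?_
    rw [le_div_iff₀ hpos, mul_comm, ← Finset.HasAntidiagonal.mem_antidiagonal.1 hp, hterm]
    exact mul_le_mul (ha _) (hb _) (hb0 _) hMa0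
  refine le_antisymm hle ?_
  have hMc0 : 0 ≤ Mc := (mul_nonneg (pow_nonneg ht 0) (β.nonneg _)).trans (hMc.2 ⟨0, rfl⟩)
  rcases hMa0.eq_or_lt with h0 | hMa1
  · rw [← h0, zero_mul]; exact hMc0
  rcases hMb0.eq_or_lt with h0 | hMb1
  · rw [← h0, mul_zero]; exact hMc0
  have hj' : ∃ j, t ^ j * β (a j) = Ma := hMa.1
  have hk' : ∃ k, t ^ k * β (b k) = Mb := hMb.1
  have hj := Nat.find_spec hj'
  have hk := Nat.find_spec hk'
  have hjmin : ∀ m < Nat.find hj', t ^ m * β (a m) < Ma := fun m hm =>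
    lt_of_le_of_ne (ha m) (Nat.find_min hj' hm)
  have hkmin : ∀ m < Nat.find hk', t ^ m * β (b m) < Mb := fun m hm =>
    lt_of_le_of_ne (hb m) (Nat.find_min hk' hm)
  generalize Nat.find hj' = j at hj hjmin
  generalize Nat.find hk' = k at hk hkmin
  have htop : t ^ (j + k) * β (a j * b k) = Ma * Mb := by rw [hterm (j, k), hj, hk]
  have hpos : 0 < t ^ (j + k) := by
    rcases (pow_nonneg ht (j + k)).eq_or_lt with h0 | h
    · rw [← h0, zero_mul] at htop
      exact absurd htop (mul_pos hMa1 hMb1).ne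
    · exact h
  -- every other term of the convolution is strictly smaller
  have hother : ∀ p ∈ Finset.HasAntidiagonal.antidiagonal (j + k), p ≠ (j, k) →
      β (a p.1 * b p.2) < β (a j * b k) := fun p hp hne => by
    have hs := Finset.HasAntidiagonal.mem_antidiagonal.1 hp
    refine lt_of_mul_lt_mul_left ?_ hpos.le
    rw [htop, ← hs, hterm]
    rcases lt_trichotomy p.1 j with h | h | h
    · exact (mul_le_mul_of_nonneg_left (hb _) (ha0 _)).trans_lt
        (mul_lt_mul_of_pos_right (hjmin _ h) hMb1)
    · exact absurd (Prod.ext h (by dsimp only; omega)) hne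
    · have h2 : p.2 < k := by omega
      exact (mul_le_mul_of_nonneg_right (ha _) (hb0 _)).trans_lt
        (mul_lt_mul_of_pos_left (hkmin _ h2) hMa1)
  have hself : β (c (j + k)) = β (a j * b k) := by
    rw [hc]
    exact IsNonarchimedean.apply_sum_eq_of_lt β.isNonarchimedean
      (fun x => (map_neg_eq_map β x).symm) (k := (j, k))
      (l := fun p : ℕ × ℕ => a p.1 * b p.2)
      (Finset.HasAntidiagonal.mem_antidiagonal.2 rfl) hother
  rw [← htop, ← hself]
  exact hMc.2 ⟨j + k, rfl⟩

/-- The function `H(β, t)(f) = maxᵢ tⁱ β((1/i!) dⁱf/dTⁱ)`; the divided derivative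
`(1/i!) dⁱ/dTⁱ` is `hasseDeriv i`, which vanishes on `f` for `i > deg f`. -/
noncomputable def HFun {N : SubmulNorm R} (β : GelfandSpectrum (gauss N)) (t : ℝ) (f : R[X]) : ℝ :=
  (Finset.range (f.natDegree + 1)).sup' Finset.nonempty_range_add_one
    fun i => t ^ i * β (hasseDeriv i f)

theorem isGreatest_HFun {N : SubmulNorm R} (β : GelfandSpectrum (gauss N)) {t : ℝ} (ht : 0 ≤ t)
    (f : R[X]) : IsGreatest (Set.range fun i => t ^ i * β (hasseDeriv i f)) (HFun β t f) := by
  constructor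
  · obtain ⟨i, _, hi⟩ := Finset.exists_mem_eq_sup' (s := Finset.range (f.natDegree + 1))
      Finset.nonempty_range_add_one fun i => t ^ i * β (hasseDeriv i f)
    exact ⟨i, hi.symm⟩
  · rintro _ ⟨i, rfl⟩
    have key : ∀ i ∈ Finset.range (f.natDegree + 1),
        t ^ i * β (hasseDeriv i f) ≤ HFun β t f := fun i hi =>
      Finset.le_sup' (fun i => t ^ i * β (hasseDeriv i f)) hi
    by_cases hi : i ∈ Finset.range (f.natDegree + 1)
    · exact key i hi
    · have h0 : hasseDeriv i f = 0 :=
        hasseDeriv_eq_zero_of_lt_natDegree f i (by simpa [Nat.lt_succ_iff] using hi)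
      have : 0 ≤ t ^ 0 * β (hasseDeriv 0 f) := mul_nonneg (pow_nonneg ht 0) (β.nonneg _)
      dsimp only
      rw [h0, map_zero, mul_zero]
      exact this.trans (key 0 (by simp))

theorem HFun_le {N : SubmulNorm R} (β : GelfandSpectrum (gauss N)) {t : ℝ} (ht : 0 ≤ t)
    {f : R[X]} {B : ℝ} (h : ∀ i, t ^ i * β (hasseDeriv i f) ≤ B) : HFun β t f ≤ B := by
  obtain ⟨i, hi⟩ := (isGreatest_HFun β ht f).1
  rw [← hi]; exact h i

theorem le_HFun {N : SubmulNorm R} (β : GelfandSpectrum (gauss N)) {t : ℝ} (ht : 0 ≤ t)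
    (f : R[X]) (i : ℕ) : t ^ i * β (hasseDeriv i f) ≤ HFun β t f :=
  (isGreatest_HFun β ht f).2 ⟨i, rfl⟩

theorem HFun_mul {N : SubmulNorm R} (β : GelfandSpectrum (gauss N)) {t : ℝ} (ht : 0 ≤ t)
    (f g : R[X]) : HFun β t (f * g) = HFun β t f * HFun β t g :=
  isGreatest_conv β ht (a := fun i => hasseDeriv i f) (b := fun i => hasseDeriv i g)
    (c := fun i => hasseDeriv i (f * g)) (fun i => hasseDeriv_mul i f g)
    (isGreatest_HFun β ht f) (isGreatest_HFun β ht g) (isGreatest_HFun β ht (f * g))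

/-- The map `H : ℳ(R[T]) × [0,1] → ℳ(R[T])`. -/
noncomputable def H {N : SubmulNorm R} (β : GelfandSpectrum (gauss N)) (t : unitInterval) :
    GelfandSpectrum (gauss N) where
  toFun := HFun β t
  map_zero' := by simp [HFun]
  add_le_max' f g := by
    refine HFun_le β t.2.1 fun i => ?_
    have ht : (0 : ℝ) ≤ (t : ℝ) ^ i := pow_nonneg t.2.1 i
    rw [map_add]
    calc (t : ℝ) ^ i * β (hasseDeriv i f + hasseDeriv i g)
        ≤ (t : ℝ) ^ i * max (β (hasseDeriv i f)) (β (hasseDeriv i g)) :=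
          mul_le_mul_of_nonneg_left (β.isNonarchimedean _ _) ht
      _ = max ((t : ℝ) ^ i * β (hasseDeriv i f)) ((t : ℝ) ^ i * β (hasseDeriv i g)) :=
          mul_max_of_nonneg _ _ ht
      _ ≤ _ := max_le_max (le_HFun β t.2.1 f i) (le_HFun β t.2.1 g i)
  neg' f := by simp [HFun, map_neg_eq_map]
  map_one_le' := by
    refine HFun_le β t.2.1 fun i => ?_
    rcases Nat.eq_zero_or_pos i with rfl | hi
    · simpa using β.map_one_le
    · rw [hasseDeriv_apply_one i hi, map_zero, mul_zero]; exact zero_le_one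
  map_mul' f g := HFun_mul β t.2.1 f g
  dominated' := by
    obtain ⟨c, hc, h⟩ := β.dominated
    refine ⟨c, hc, fun f => HFun_le β t.2.1 fun i => ?_⟩
    calc (t : ℝ) ^ i * β (hasseDeriv i f) ≤ 1 * β (hasseDeriv i f) :=
          mul_le_mul_of_nonneg_right (pow_le_one₀ t.2.1 t.2.2) (β.nonneg _)
      _ ≤ c * gauss N (hasseDeriv i f) := by rw [one_mul]; exact h _
      _ ≤ c * gauss N f := mul_le_mul_of_nonneg_left (gauss_hasseDeriv_le N i f) hc.le

theorem H_apply {N : SubmulNorm R} (β : GelfandSpectrum (gauss N)) (t : unitInterval) (f : R[X]) :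
    H β t f = HFun β t f := rfl

theorem H_zero {N : SubmulNorm R} (β : GelfandSpectrum (gauss N)) : H β 0 = β := by
  ext f
  rw [H_apply]
  refine le_antisymm (HFun_le β le_rfl fun i => ?_) ?_
  · rcases Nat.eq_zero_or_pos i with rfl | hi
    · simp
    · simp [hi.ne', β.nonneg]
  · simpa using le_HFun β (t := 0) le_rfl f 0

theorem isClosed_setOf_H_eq {N : SubmulNorm R} (β : GelfandSpectrum (gauss N)) :
    IsClosed {s : unitInterval | H β s = β} := by
  have : {s : unitInterval | H β s = β} = ⋂ f : R[X], {s : unitInterval | HFun β s f = β f} := by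
    refine Set.ext fun s => ?_
    simp only [Set.mem_ofPred_eq, Set.mem_iInter]
    exact ⟨fun h f => by rw [← H_apply, h], fun h => GelfandSpectrum.ext h⟩
  rw [this]
  refine isClosed_iInter fun f => isClosed_eq ?_ continuous_const
  unfold HFun
  exact Continuous.finset_sup'_apply _ fun i _ => by fun_prop

/-- The radius `r(β)`: the greatest `s ∈ [0,1]` with `H(β, s) = β`. -/
noncomputable def radius {N : SubmulNorm R} (β : GelfandSpectrum (gauss N)) : unitInterval :=
  sSup {s : unitInterval | H β s = β}

/-- The supremum defining the radius is attained. -/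
theorem isGreatest_radius {N : SubmulNorm R} (β : GelfandSpectrum (gauss N)) :
    IsGreatest {s : unitInterval | H β s = β} (radius β) :=
  ⟨(isClosed_setOf_H_eq β).isCompact.sSup_mem ⟨0, H_zero β⟩, fun _ hs => le_sSup hs⟩

/-- `r x y` (read: `x` dominates `y`) makes `X` a tree: it is a partial order with a largest
element, in which any two elements dominating a common third element are comparable. -/
structure IsTree {X : Type*} (r : X → X → Prop) : Prop where
  isPartialOrder : IsPartialOrder X r
  exists_largest : ∃ x, ∀ y, r x y
  comparable : ∀ x y z, r x z → r y z → r x y ∨ r y x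

end GelfandTree

namespace GelfandTree

open Polynomial

/-! ### Domination of multiplicative seminorms -/

section Order

variable {A : Type*} [CommRing A] {N : SubmulNorm A}

/-! Multiplicativity turns domination into pointwise inequality, and everything reduces to one claim
(`exists_eq_H`): a point `β ≥ γ` of the same fibre is `H γ s` for some `s`. The path `s ↦ H γ s` is
increasing, so the points above `γ` form a chain; the radius statements follow from formal
identities for `H`.

For the claim, let `K` be the completed residue field of the common restriction. The points `β` and
`γ` become coordinates `t`, `t'` in two complete extensions of `K`, and an algebraic closure `L` of
`K` embeds isometrically into algebraic closures of both. Put `d a = |t - a|` and `e a = |t' - a|`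
for `a` in `L`. The value of `β` (resp. `γ`) at the minimal polynomial of `a` is the product of `d`
(resp. `e`) over the conjugates of `a`, and it is a strictly increasing function of the least
distance to a conjugate. Hence `β ≥ γ` says that the least `e`-distance to each conjugacy class is
at most the least `d`-distance.

With `s = inf d`, an ultrametric argument (`IsDistance.prod_eq_prod_max`) shows that the least
`d`-distance is the maximum of `s` and the least `e`-distance. So `β` is the generic point of the
closed disc of centre `t'` and radius `s`. Taylor expansion at `t'` identifies this point with `H γ
s`. -/

theorem GelfandSpectrum.map_pow (α : GelfandSpectrum N) (a : A) {n : ℕ} (hn : n ≠ 0) :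
    α (a ^ n) = α a ^ n := by
  induction n with
  | zero => exact absurd rfl hn
  | succ n ih =>
    rcases eq_or_ne n 0 with rfl | h
    · simp
    · rw [pow_succ, map_mul, ih h, pow_succ]

/-- A constant in a power-multiplicative inequality can be removed. -/
theorem le_of_forall_pow_le_mul_pow {x y c : ℝ} (hy : 0 ≤ y)
    (h : ∀ n : ℕ, n ≠ 0 → x ^ n ≤ c * y ^ n) : x ≤ y := by
  by_contra! hlt
  rcases hy.eq_or_lt with rfl | hy
  · have := h 1 one_ne_zero
    simp at this
    linarith
  · have h1 : 1 < x / y := (one_lt_div hy).2 hlt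
    obtain ⟨n, hn⟩ := pow_unbounded_of_one_lt c h1
    -- The shift to `n + 1` keeps the exponent nonzero; exponent `0` is excluded because a
    -- multiplicative seminorm may vanish at `1`.
    have h2 : c < (x / y) ^ (n + 1) :=
      hn.trans_le (pow_le_pow_right₀ h1.le n.le_succ)
    rw [div_pow, lt_div_iff₀ (pow_pos hy _)] at h2
    exact (h (n + 1) n.succ_ne_zero).not_gt h2

/-- Applying the inequality to powers of `a` and taking roots makes the constant disappear. -/
theorem dominates_iff_le (α α' : GelfandSpectrum N) : Dominates α α' ↔ ∀ a, α' a ≤ α a := by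
  constructor
  · rintro ⟨c, _, h⟩ a
    refine le_of_forall_pow_le_mul_pow (c := c) (α.nonneg a) fun n hn => ?_
    rw [← α.map_pow a hn, ← α'.map_pow a hn]
    exact h _
  · exact fun h => ⟨1, one_pos, fun a => by simpa using h a⟩

theorem GelfandSpectrum.nsmul_le (α : GelfandSpectrum N) (n : ℕ) (a : A) : α (n • a) ≤ α a := by
  have h := sum_le_of_forall_le α (Finset.range n) (fun _ => a) (α.nonneg a) (fun _ _ => le_rfl)
  simpa using h

theorem GelfandSpectrum.map_one_eq (α : GelfandSpectrum N) (h : ∃ a, α a ≠ 0) : α 1 = 1 := by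
  obtain ⟨a, ha⟩ := h
  have := map_mul α 1 a
  rw [one_mul] at this
  exact (mul_right_cancel₀ ha (by rw [one_mul, ← this])).symm

theorem GelfandSpectrum.eq_zero_of_map_one (α : GelfandSpectrum N) (h : α 1 = 0) (a : A) :
    α a = 0 := by
  rw [← one_mul a, map_mul, h, zero_mul]

end Order

variable {R : Type*} [CommRing R] {N : SubmulNorm R}

/-! ### Formal properties of the homotopy -/

section HProperties

variable (β γ : GelfandSpectrum (gauss N)) (s t : unitInterval)

theorem le_H (f : R[X]) : β f ≤ HFun β s f :=
  by simpa using le_HFun β s.2.1 f 0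

theorem H_mono_left {β γ : GelfandSpectrum (gauss N)} (h : ∀ f, γ f ≤ β f) (f : R[X]) :
    H γ s f ≤ H β s f :=
  HFun_le γ s.2.1 fun i =>
    (mul_le_mul_of_nonneg_left (h _) (pow_nonneg s.2.1 i)).trans (le_HFun β s.2.1 f i)

theorem H_mono_right {s t : unitInterval} (h : s ≤ t) (f : R[X]) : H β s f ≤ H β t f :=
  HFun_le β s.2.1 fun i =>
    (mul_le_mul_of_nonneg_right (pow_le_pow_left₀ s.2.1 h i) (β.nonneg _)).trans
      (le_HFun β t.2.1 f i)

/-- A composite of divided derivatives is an integer multiple of a divided derivative, and integer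
multiples do not increase a nonarchimedean seminorm. -/
theorem H_H_self : H (H β s) s = H β s := by
  refine GelfandSpectrum.ext fun f => le_antisymm ?_ (le_H _ _ _)
  refine HFun_le _ s.2.1 fun i => ?_
  obtain ⟨j, hj⟩ := (isGreatest_HFun β s.2.1 (hasseDeriv i f)).1
  rw [H_apply, ← hj]
  dsimp only
  have hc : hasseDeriv j (hasseDeriv i f) = (j + i).choose j • hasseDeriv (j + i) f := by
    rw [← LinearMap.comp_apply, hasseDeriv_comp]
    simp
  rw [hc, ← mul_assoc, ← pow_add, add_comm i j]
  exact (mul_le_mul_of_nonneg_left (β.nsmul_le _ _) (pow_nonneg s.2.1 _)).trans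
    (le_HFun β s.2.1 f _)

/-- Divided derivatives commute, so the bound expressed by `h` can be applied to the polynomial
`hasseDeriv j f`. -/
theorem H_H_eq_of_H_eq (h : H γ t = γ) : H (H γ s) t = H γ s := by
  refine GelfandSpectrum.ext fun f => le_antisymm ?_ (le_H _ _ _)
  refine HFun_le _ t.2.1 fun i => ?_
  obtain ⟨j, hj⟩ := (isGreatest_HFun γ s.2.1 (hasseDeriv i f)).1
  rw [H_apply, ← hj]
  dsimp only
  have hc : hasseDeriv j (hasseDeriv i f) = hasseDeriv i (hasseDeriv j f) := by
    rw [← LinearMap.comp_apply, ← LinearMap.comp_apply, hasseDeriv_comp, hasseDeriv_comp,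
      add_comm i j, ← Nat.choose_symm_add]
  have h1 : (t : ℝ) ^ i * γ (hasseDeriv i (hasseDeriv j f)) ≤ γ (hasseDeriv j f) := by
    refine (le_HFun γ t.2.1 (hasseDeriv j f) i).trans ?_
    rw [← H_apply, h]
  rw [hc, mul_left_comm]
  exact (mul_le_mul_of_nonneg_left h1 (pow_nonneg s.2.1 j)).trans (le_HFun γ s.2.1 f j)

theorem mu_H : mu (H β s) = mu β := by
  refine GelfandSpectrum.ext fun a => le_antisymm ?_ (le_H β s (C a))
  refine HFun_le β s.2.1 fun i => ?_
  rcases Nat.eq_zero_or_pos i with rfl | hi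
  · simp; rfl
  · rw [hasseDeriv_C i a hi, map_zero, mul_zero]
    exact β.nonneg _

end HProperties

/-! ### Radii along a path -/

/-- If `β` lies on the path from `γ`, its parameter may be taken to be the radius of `β`. -/
theorem eq_H_radius {β γ : GelfandSpectrum (gauss N)} (hle : ∀ f, γ f ≤ β f) {s : unitInterval}
    (h : β = H γ s) : β = H γ (radius β) := by
  have hr : H β (radius β) = β := (isGreatest_radius β).1
  have hs : s ≤ radius β := (isGreatest_radius β).2 (by
    change H β s = β
    rw [h, H_H_self])
  -- Sandwich with `r = radius β`: `β = H γ s ≤ H γ r ≤ H β r = β`.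
  refine GelfandSpectrum.ext fun f => le_antisymm ?_ ?_
  · conv_lhs => rw [h]
    exact H_mono_right γ hs f
  · conv_rhs => rw [← hr]
    exact H_mono_left _ hle f

theorem radius_le_radius {β γ : GelfandSpectrum (gauss N)} {s : unitInterval} (h : β = H γ s) :
    radius γ ≤ radius β :=
  (isGreatest_radius β).2 (by
    change H β (radius γ) = β
    rw [h]
    exact H_H_eq_of_H_eq γ s _ (isGreatest_radius γ).1)

theorem radius_eq_iff {β γ : GelfandSpectrum (gauss N)} (h : β = H γ (radius β)) :
    radius β = radius γ ↔ β = γ := by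
  refine ⟨fun hr => ?_, fun h => by rw [h]⟩
  rw [h, hr]
  exact (isGreatest_radius γ).1

/-! ### The largest point of a fibre and the tree axioms -/

/-- The point of the fibre over `α` given by evaluation at `0`. -/
noncomputable def evalZero (α : GelfandSpectrum N) : GelfandSpectrum (gauss N) where
  toFun f := α (f.coeff 0)
  map_zero' := by simp
  add_le_max' f g := by rw [coeff_add]; exact α.isNonarchimedean _ _
  neg' f := by rw [coeff_neg, map_neg_eq_map]
  map_one_le' := by rw [coeff_one_zero]; exact α.map_one_le
  map_mul' f g := by rw [mul_coeff_zero, map_mul]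
  dominated' := by
    obtain ⟨c, hc, h⟩ := α.dominated
    exact ⟨c, hc, fun f => (h _).trans
      (mul_le_mul_of_nonneg_left (coeff_le_gaussNorm N f 0) hc.le)⟩

theorem evalZero_apply (α : GelfandSpectrum N) (f : R[X]) : evalZero α f = α (f.coeff 0) := rfl

theorem mu_evalZero (α : GelfandSpectrum N) : mu (evalZero α) = α :=
  GelfandSpectrum.ext fun a => by
    change α ((C a).coeff 0) = α a
    rw [coeff_C_zero]

/-- All positive powers of `X` have the same Gauss norm `N 1`, so the powers of `β X` stay bounded.
-/
theorem GelfandSpectrum.map_X_le (β : GelfandSpectrum (gauss N)) : β X ≤ 1 := by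
  obtain ⟨c, hc, h⟩ := β.dominated
  refine le_of_forall_pow_le_mul_pow (c := c * N 1) zero_le_one fun n hn => ?_
  rw [← β.map_pow _ hn, one_pow, mul_one]
  refine (h _).trans (mul_le_mul_of_nonneg_left ?_ hc.le)
  rw [← monomial_one_right_eq_X_pow, gauss_apply, gaussNorm_monomial, one_pow, mul_one]

/-- The constant term of `hasseDeriv i f` is the `i`-th coefficient of `f`, so the right side is the
largest value of `mu β` on coefficients. It bounds `β f` because `β X ≤ 1`. This provides the
largest element of the fibre. -/
theorem le_H_evalZero (β : GelfandSpectrum (gauss N)) (f : R[X]) :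
    β f ≤ H (evalZero (mu β)) 1 f := by
  rw [f.as_sum_range_C_mul_X_pow]
  conv_rhs => rw [← f.as_sum_range_C_mul_X_pow]
  refine sum_le_of_forall_le β _ _ (GelfandSpectrum.nonneg _ _) fun i _ => ?_
  have h1 := le_HFun (evalZero (mu β)) (t := 1) zero_le_one f i
  rw [one_pow, one_mul, evalZero_apply, hasseDeriv_coeff, zero_add, Nat.choose_self, Nat.cast_one,
    one_mul] at h1
  refine le_trans ?_ h1
  change β (C (f.coeff i) * X ^ i) ≤ β (C (f.coeff i))
  rw [map_mul]
  rcases eq_or_ne i 0 with rfl | hi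
  · rw [pow_zero]
    exact mul_le_of_le_one_right (β.nonneg _) β.map_one_le
  · rw [β.map_pow _ hi]
    exact mul_le_of_le_one_right (β.nonneg _) (pow_le_one₀ (β.nonneg _) β.map_X_le)

/-- A fibre is a tree as soon as every point dominating `γ` is of the form `H γ s`. -/
theorem isTree_of_eq_H (α : GelfandSpectrum N)
    (h : ∀ β γ : GelfandSpectrum (gauss N), mu β = mu γ → (∀ f, γ f ≤ β f) → ∃ s, β = H γ s) :
    IsTree (fun β γ : {δ : GelfandSpectrum (gauss N) // mu δ = α} => Dominates β.1 γ.1) where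
  isPartialOrder :=
    { refl := fun β => (dominates_iff_le _ _).2 fun _ => le_rfl
      trans := fun β γ δ h1 h2 => by
        rw [dominates_iff_le] at *
        exact fun f => (h2 f).trans (h1 f)
      antisymm := fun β γ h1 h2 => by
        rw [dominates_iff_le] at *
        exact Subtype.ext (GelfandSpectrum.ext fun f => le_antisymm (h2 f) (h1 f)) }
  exists_largest := by
    refine ⟨⟨H (evalZero α) 1, by rw [mu_H, mu_evalZero]⟩, ?_⟩
    rintro ⟨β, rfl⟩
    exact (dominates_iff_le _ _).2 (le_H_evalZero β)
  comparable := by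
    rintro ⟨β, hβ⟩ ⟨β', hβ'⟩ ⟨γ, hγ⟩ h1 h2
    rw [dominates_iff_le] at h1 h2
    obtain ⟨s, rfl⟩ := h β γ (hβ.trans hγ.symm) h1
    obtain ⟨t, rfl⟩ := h β' γ (hβ'.trans hγ.symm) h2
    simp only [dominates_iff_le]
    exact (le_total t s).imp (fun h => H_mono_right γ h) fun h => H_mono_right γ h

/-! ### Extension of complete absolute values to algebraic extensions -/

section AbsoluteValues

/-- A normed field with an element of norm different from `0` and `1` is nontrivially normed. -/
theorem exists_one_lt_norm {K : Type*} [NormedField K] (h : ∃ x : K, x ≠ 0 ∧ ‖x‖ ≠ 1) :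
    ∃ x : K, 1 < ‖x‖ := by
  obtain ⟨x, hx, hx1⟩ := h
  rcases lt_or_gt_of_ne hx1 with h | h
  · exact ⟨x⁻¹, by rw [norm_inv]; exact (one_lt_inv₀ (norm_pos_iff.2 hx)).2 h⟩
  · exact ⟨x, h⟩

variable {K L : Type*} [NormedField K] [CompleteSpace K] [IsUltrametricDist K] [Field L]
  [Algebra K L] [Algebra.IsAlgebraic K L]

/-- A complete nonarchimedean absolute value, possibly trivial, extends to every algebraic
extension. -/
theorem exists_absoluteValue_extending :
    ∃ v : AbsoluteValue L ℝ, IsNonarchimedean v ∧ ∀ x : K, v (algebraMap K L x) = ‖x‖ := by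
  classical
  by_cases h : ∃ x : K, x ≠ 0 ∧ ‖x‖ ≠ 1
  · let : NontriviallyNormedField K :=
      { ‹NormedField K› with non_trivial := exists_one_lt_norm h }
    let := spectralNorm.normedField K L
    exact ⟨NormedField.toAbsoluteValue L, isNonarchimedean_spectralNorm (K := K) (L := L),
      fun x => spectralNorm_extends (K := K) (L := L) x⟩
  · push Not at h
    refine ⟨AbsoluteValue.trivial, fun x y => ?_, fun x => ?_⟩
    · by_cases hx : x = 0
      · simp [hx]
      by_cases hy : y = 0
      · simp [hy]
      rw [AbsoluteValue.trivial_apply hx, AbsoluteValue.trivial_apply hy, max_self]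
      by_cases hxy : x + y = 0
      · simp [hxy]
      · rw [AbsoluteValue.trivial_apply hxy]
    · by_cases hx : x = 0
      · simp [hx]
      · rw [h x hx, AbsoluteValue.trivial_apply (by simpa using hx)]

/-- An absolute value on an extension of `K`, as an algebra norm. -/
def algebraNormOfAbsoluteValue (v : AbsoluteValue L ℝ) (hv : ∀ x : K, v (algebraMap K L x) = ‖x‖) :
    AlgebraNorm K L where
  toFun := v
  map_zero' := v.map_zero
  add_le' := v.add_le
  neg' := v.map_neg
  mul_le' x y := (v.map_mul x y).le
  eq_zero_of_map_eq_zero' x hx := v.eq_zero.1 hx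
  smul' k x := by
    change v (k • x) = ‖k‖ * v x
    rw [Algebra.smul_def, v.map_mul, hv]

/-- The extension of a complete nonarchimedean absolute value, possibly trivial, to an algebraic
extension is unique. -/
theorem absoluteValue_extending_unique {v w : AbsoluteValue L ℝ} (hv : IsNonarchimedean v)
    (hw : IsNonarchimedean w) (hvK : ∀ x : K, v (algebraMap K L x) = ‖x‖)
    (hwK : ∀ x : K, w (algebraMap K L x) = ‖x‖) (x : L) : v x = w x := by
  by_cases h : ∃ x : K, x ≠ 0 ∧ ‖x‖ ≠ 1
  · let : NontriviallyNormedField K :=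
      { ‹NormedField K› with non_trivial := exists_one_lt_norm h }
    rw [spectralNorm_unique_field_norm_ext (K := K) hvK, spectralNorm_unique_field_norm_ext hwK]
  · push Not at h
    have hle : ∀ u : AbsoluteValue L ℝ, IsNonarchimedean u →
        (∀ x : K, u (algebraMap K L x) = ‖x‖) → ∀ x, u x ≤ 1 := fun u hu huK x => by
      refine (norm_le_spectralNorm (f := algebraNormOfAbsoluteValue u huK)
        (fun a n _ => map_pow u a n) hu (Algebra.IsAlgebraic.isAlgebraic x)).trans ?_
      -- In the trivially valued case every coefficient of a minimal polynomial has norm `0` or `1`,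
      -- so extensions are bounded by `1`; passing to inverses then forces the value `1`.
      refine (spectralValue_le_one_iff
        (minpoly.monic (Algebra.IsIntegral.isIntegral x))).2 fun n => ?_
      by_cases h0 : (minpoly K x).coeff n = 0
      · simp [h0]
      · exact (h _ h0).le
    have heq : ∀ u : AbsoluteValue L ℝ, IsNonarchimedean u →
        (∀ x : K, u (algebraMap K L x) = ‖x‖) → ∀ x, x ≠ 0 → u x = 1 := fun u hu huK x hx => by
      refine le_antisymm (hle u hu huK x) ?_
      have := hle u hu huK x⁻¹
      rwa [map_inv₀, inv_le_one₀ (u.pos hx)] at this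
    by_cases hx : x = 0
    · simp [hx]
    · rw [heq v hv hvK x hx, heq w hw hwK x hx]

/-- The composite of `v` with `σ` extends the same norm on `K`, so uniqueness applies. -/
theorem absoluteValue_algEquiv {v : AbsoluteValue L ℝ} (hv : IsNonarchimedean v)
    (hvK : ∀ x : K, v (algebraMap K L x) = ‖x‖) (σ : L ≃ₐ[K] L) (x : L) : v (σ x) = v x :=
  absoluteValue_extending_unique (K := K) (v := v.comp (f := (σ : L →+* L)) σ.injective) (w := v)
    (fun a b => by
      change v (σ (a + b)) ≤ max (v (σ a)) (v (σ b))
      rw [map_add]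
      exact hv _ _) hv
    (fun a => by
      change v (σ (algebraMap K L a)) = _
      rw [σ.commutes, hvK]) hvK x

end AbsoluteValues

/-- An isometric embedding of complete fields extends to an algebraic extension, with values in
an algebraic closure of the target. -/
theorem exists_isometric_extension {K L M : Type*} [NormedField K] [CompleteSpace K]
    [IsUltrametricDist K] [Field L] [Algebra K L] [Algebra.IsAlgebraic K L]
    {v : AbsoluteValue L ℝ} (hv : IsNonarchimedean v) (hvK : ∀ x : K, v (algebraMap K L x) = ‖x‖)
    [NormedField M] [CompleteSpace M] [IsUltrametricDist M] (j : K →+* M)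
    (hj : ∀ x, ‖j x‖ = ‖x‖) :
    ∃ (w : AbsoluteValue (AlgebraicClosure M) ℝ) (ι : L →+* AlgebraicClosure M),
      IsNonarchimedean w ∧ (∀ x : M, w (algebraMap M _ x) = ‖x‖) ∧
      (∀ x, ι (algebraMap K L x) = algebraMap M _ (j x)) ∧ ∀ x, w (ι x) = v x := by
  obtain ⟨w, hw, hwM⟩ := exists_absoluteValue_extending (K := M) (L := AlgebraicClosure M)
  let : Algebra K (AlgebraicClosure M) := ((algebraMap M (AlgebraicClosure M)).comp j).toAlgebra
  let ι : L →ₐ[K] AlgebraicClosure M := IsAlgClosed.lift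
  refine ⟨w, ι, hw, hwM, fun x => ι.commutes x, fun x => ?_⟩
  -- Any embedding over `K` is automatically isometric: `w` pulled back along `ι` extends the norm
  -- of `K`, as `v` does.
  refine absoluteValue_extending_unique (K := K)
    (v := w.comp (f := (ι : L →+* AlgebraicClosure M)) ι.injective) (w := v) ?_ hv
    (fun a => ?_) hvK x
  · intro a b
    change w (ι (a + b)) ≤ max (w (ι a)) (w (ι b))
    rw [map_add]
    exact hw _ _
  · change w (ι (algebraMap K L a)) = _
    rw [ι.commutes]
    exact (hwM _).trans (hj a)

/-! ### Distances to conjugates -/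

section Distances

variable {K L : Type*} [Field K] [Field L] [Algebra K L]

/-- The function `d` measures the distances from a point to the elements of `L`, in some
nonarchimedean extension of `(L, v)`. -/
structure IsDistance (v : AbsoluteValue L ℝ) (d : L → ℝ) : Prop where
  nonneg : ∀ a, 0 ≤ d a
  le_max : ∀ a b, d a ≤ max (d b) (v (a - b))
  sub_le_max : ∀ a b, v (a - b) ≤ max (d a) (d b)

variable {v : AbsoluteValue L ℝ} {d e : L → ℝ}

/-- For `s ≥ 0` this corresponds to replacing the point by the generic point of the disc of radius
`s` around it. -/
theorem IsDistance.max_left (hd : IsDistance v d) (s : ℝ) :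
    IsDistance v fun a => max s (d a) where
  nonneg a := le_max_of_le_right (hd.nonneg a)
  le_max a b := max_le (le_max_of_le_left (le_max_left _ _))
    ((hd.le_max a b).trans (max_le_max (le_max_right _ _) le_rfl))
  sub_le_max a b := (hd.sub_le_max a b).trans (max_le_max (le_max_right _ _) (le_max_right _ _))

/-- The value of the minimal polynomial of `a` at a point at distance `x` from `a` to which
no conjugate of `a` is closer. -/
noncomputable def conjProd (K : Type*) [Field K] [Algebra K L] (v : AbsoluteValue L ℝ) (a : L)
    (x : ℝ) : ℝ :=
  (((minpoly K a).aroots L).map fun b => max x (v (b - a))).prod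

/-- The factor at the root `a` itself is exactly `x`, hence strictly increasing; the other factors
are monotone, and positive at the larger argument. -/
theorem conjProd_strictMonoOn {a : L} (ha : IsIntegral K a) :
    StrictMonoOn (conjProd K v a) (Set.Ici 0) := by
  intro x hx y _ hxy
  have hmem : a ∈ (minpoly K a).aroots L :=
    (mem_aroots.2 ⟨minpoly.ne_zero ha, minpoly.aeval K a⟩)
  obtain ⟨s, hs⟩ := Multiset.exists_cons_of_mem hmem
  have hx : 0 ≤ x := hx
  have hy0 : 0 < y := hx.trans_lt hxy
  have hyx : ∀ b, max x (v (b - a)) ≤ max y (v (b - a)) := fun b => max_le_max hxy.le le_rfl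
  have hy1 : 0 < (s.map fun b => max y (v (b - a))).prod :=
    Multiset.prod_pos fun z hz => by
      obtain ⟨b, -, rfl⟩ := Multiset.mem_map.1 hz
      exact lt_max_of_lt_left hy0
  have hle : (s.map fun b => max x (v (b - a))).prod ≤ (s.map fun b => max y (v (b - a))).prod :=
    Multiset.prod_map_le_prod_map₀ _ _ (fun b _ => le_max_of_le_left hx) fun b _ => hyx b
  unfold conjProd
  rw [hs, Multiset.map_cons, Multiset.map_cons, Multiset.prod_cons, Multiset.prod_cons, sub_self,
    map_zero, max_eq_left hx, max_eq_left hy0.le]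
  exact (mul_le_mul_of_nonneg_left hle hx).trans_lt (mul_lt_mul_of_pos_right hxy hy1)

theorem mem_aroots_minpoly_iff {a b : L} (ha : IsIntegral K a) :
    b ∈ (minpoly K a).aroots L ↔ minpoly K b = minpoly K a := by
  rw [mem_aroots, and_iff_right (minpoly.ne_zero ha)]
  refine ⟨fun h => ?_, fun h => by rw [← h, minpoly.aeval]⟩
  exact (minpoly.eq_of_irreducible_of_monic (minpoly.irreducible ha) h (minpoly.monic ha)).symm

variable [Normal K L]

/-- The automorphism permutes the roots of the minimal polynomial and preserves `v`. -/
theorem conjProd_algEquiv (hσ : ∀ (σ : L ≃ₐ[K] L) x, v (σ x) = v x) (σ : L ≃ₐ[K] L) (a : L)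
    (x : ℝ) : conjProd K v (σ a) x = conjProd K v a x := by
  unfold conjProd
  rw [minpoly.algEquiv_eq]
  have hroots : ((minpoly K a).aroots L).map σ = (minpoly K a).aroots L := by
    have h := (Normal.splits (F := K) (K := L) inferInstance a).roots_map (σ : L →+* L)
    rw [Polynomial.map_map] at h
    have hc : (σ : L →+* L).comp (algebraMap K L) = algebraMap K L :=
      RingHom.ext fun x => σ.commutes x
    rw [hc] at h
    exact h.symm
  conv_lhs => rw [← hroots]
  rw [Multiset.map_map]
  refine congrArg _ (Multiset.map_congr rfl fun b _ => ?_)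
  rw [Function.comp_apply, ← map_sub, hσ]

theorem conjProd_eq_of_minpoly_eq (hσ : ∀ (σ : L ≃ₐ[K] L) x, v (σ x) = v x) {a b : L}
    (h : minpoly K a = minpoly K b) : conjProd K v a = conjProd K v b := by
  obtain ⟨σ, rfl⟩ := IsConjRoot.exists_algEquiv (K := K) h
  exact funext fun x => conjProd_algEquiv hσ σ b x

theorem exists_minimal_conj (d : L → ℝ) (a : L) :
    ∃ c, minpoly K c = minpoly K a ∧ ∀ b, minpoly K b = minpoly K a → d c ≤ d b := by
  classical
  have ha : IsIntegral K a := Normal.isIntegral inferInstance a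
  obtain ⟨c, hc, hmin⟩ := Finset.exists_min_image ((minpoly K a).aroots L).toFinset d
    ⟨a, Multiset.mem_toFinset.2 ((mem_aroots_minpoly_iff ha).2 rfl)⟩
  rw [Multiset.mem_toFinset, mem_aroots_minpoly_iff ha] at hc
  exact ⟨c, hc, fun b hb => hmin b (Multiset.mem_toFinset.2 ((mem_aroots_minpoly_iff ha).2 hb))⟩

/-- If `c` is a nearest conjugate, the ultrametric inequality gives `d b = max (d c) (v (b - c))`
for every conjugate `b`. The whole product thus depends only on the least distance. -/
theorem IsDistance.prod_eq_conjProd (hd : IsDistance v d)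
    (hσ : ∀ (σ : L ≃ₐ[K] L) x, v (σ x) = v x) {a c : L} (hc : minpoly K c = minpoly K a)
    (hmin : ∀ b, minpoly K b = minpoly K a → d c ≤ d b) :
    (((minpoly K a).aroots L).map d).prod = conjProd K v a (d c) := by
  rw [← conjProd_eq_of_minpoly_eq hσ hc, conjProd, hc]
  refine congrArg _ (Multiset.map_congr rfl fun b hb => le_antisymm (hd.le_max b c) ?_)
  rw [mem_aroots_minpoly_iff (Normal.isIntegral inferInstance a)] at hb
  exact max_le (hmin b hb) ((hd.sub_le_max b c).trans (max_le le_rfl (hmin b hb)))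

/-- Comparison of two points of the line over `K` through their distances to algebraic points:
if `e` is below `d` on minimal polynomials, `d` arises from `e` by enlarging the radius. -/
theorem IsDistance.prod_eq_prod_max (hd : IsDistance v d) (he : IsDistance v e)
    (hσ : ∀ (σ : L ≃ₐ[K] L) x, v (σ x) = v x)
    (hle : ∀ a : L, (((minpoly K a).aroots L).map e).prod ≤ (((minpoly K a).aroots L).map d).prod)
    (a : L) : (((minpoly K a).aroots L).map d).prod =
      (((minpoly K a).aroots L).map fun b => max (⨅ x, d x) (e b)).prod := by
  set s := ⨅ x, d x with hs
  have hbdd : BddBelow (Set.range d) := ⟨0, by rintro _ ⟨x, rfl⟩; exact hd.nonneg x⟩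
  -- Strict monotonicity of `conjProd` converts the inequality of products into one of least
  -- distances.
  have hmin_le : ∀ a c c' : L, minpoly K c = minpoly K a →
      (∀ b, minpoly K b = minpoly K a → d c ≤ d b) → minpoly K c' = minpoly K a →
      (∀ b, minpoly K b = minpoly K a → e c' ≤ e b) → e c' ≤ d c := by
    intro a c c' hc hcm hc' hcm'
    have h := hle a
    rw [hd.prod_eq_conjProd hσ hc hcm, he.prod_eq_conjProd hσ hc' hcm'] at h
    exact ((conjProd_strictMonoOn (Normal.isIntegral inferInstance a)).le_iff_le (he.nonneg _)
      (hd.nonneg _)).1 h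
  obtain ⟨c, hc, hcm⟩ := exists_minimal_conj (K := K) d a
  obtain ⟨c', hc', hcm'⟩ := exists_minimal_conj (K := K) e a
  rw [hd.prod_eq_conjProd hσ hc hcm, (he.max_left s).prod_eq_conjProd hσ hc'
    fun b hb => max_le_max le_rfl (hcm' b hb)]
  refine congrArg _ (le_antisymm ?_ (max_le (ciInf_le hbdd c) (hmin_le a c c' hc hcm hc' hcm')))
  -- If `d c` exceeds both `s` and `e c'`, some conjugacy class comes `d`-closer than `c`. Take `b`
  -- in it `d`-nearest and `b'` in it `e`-nearest, so that `e b' ≤ d b < d c`.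
  by_contra! hlt
  obtain ⟨hs1, he1⟩ := max_lt_iff.1 hlt
  obtain ⟨x, hx⟩ := exists_lt_of_ciInf_lt hs1
  obtain ⟨b, hb, hbm⟩ := exists_minimal_conj (K := K) d x
  obtain ⟨b', hb', hbm'⟩ := exists_minimal_conj (K := K) e x
  have hbx : d b < d c := (hbm x rfl).trans_lt hx
  obtain ⟨τ, hτ⟩ := IsConjRoot.exists_algEquiv (K := K) (x := b) (y := b') (hb.trans hb'.symm)
  -- No conjugate of `c` is `d`-closer than `c`, while `b` is, so `τ c'` is far from `b`. Transport
  -- by `τ` gives `d c ≤ v (c' - b') ≤ max (e c') (e b')`, a contradiction.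
  have h1 : d c ≤ v (τ c' - b) := by
    have h2 := (hcm (τ c') (by rw [minpoly.algEquiv_eq, hc'])).trans (hd.le_max (τ c') b)
    exact (le_max_iff.1 h2).resolve_left hbx.not_ge
  rw [← hτ, ← map_sub, hσ] at h1
  refine (h1.trans (he.sub_le_max c' b')).not_gt (max_lt he1 ?_)
  exact (hmin_le x b b' hb hbm hb' hbm').trans_lt hbx

end Distances

open scoped NNReal

universe u

/-! ### Completed residue fields -/

section ResidueField

variable {A : Type*} [CommRing A] {N : SubmulNorm A}

/-- A nonzero point of the spectrum, as a valuation with real values. -/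
def GelfandSpectrum.toValuation (α : GelfandSpectrum N) (h1 : α 1 = 1) : Valuation A ℝ≥0 where
  toFun a := ⟨α a, α.nonneg a⟩
  map_zero' := NNReal.eq (map_zero α)
  map_one' := NNReal.eq h1
  map_mul' a b := NNReal.eq (map_mul α a b)
  map_add_le_max' a b := (α.isNonarchimedean a b :)

/-- A real-valued valuation on a field, as an absolute value. -/
noncomputable def absoluteValueOfValuation {F : Type*} [Field F] (v : Valuation F ℝ≥0) : AbsoluteValue F ℝ where
  toFun x := v x
  map_mul' x y := by rw [map_mul, NNReal.coe_mul]
  nonneg' x := (v x).2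
  eq_zero' x := by rw [NNReal.coe_eq_zero, map_eq_zero]
  add_le' x y := by
    rw [← NNReal.coe_add, NNReal.coe_le_coe]
    exact (v.map_add x y).trans (max_le_add_of_nonneg zero_le zero_le)

/-- The residue field of a nonzero point of the spectrum. -/
theorem exists_residueField {A : Type u} [CommRing A] {N : SubmulNorm A} (α : GelfandSpectrum N)
    (h1 : α 1 = 1) :
    ∃ (F : Type u) (_ : Field F) (v : AbsoluteValue F ℝ) (φ : A →+* F), IsNonarchimedean v ∧
      (∀ a, v (φ a) = α a) ∧ (∀ x, ∃ a b, φ b ≠ 0 ∧ x = φ a / φ b) ∧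
      ∀ (M : Type u) [Field M] (ψ : A →+* M), (∀ a, ψ a = 0 ↔ α a = 0) →
        ∃ j : F →+* M, ∀ a, j (φ a) = ψ a := by
  let w := α.toValuation h1
  have hw : ∀ a, ((w a : ℝ≥0) : ℝ) = α a := fun _ => rfl
  have hmem : ∀ a, a ∈ w.supp ↔ α a = 0 := fun a => by
    rw [Valuation.mem_supp_iff, ← NNReal.coe_eq_zero, hw]
  let B := A ⧸ w.supp
  let wB : Valuation B ℝ≥0 := w.onQuot le_rfl
  have hwB : ∀ a, wB (Ideal.Quotient.mk _ a) = w a := fun _ => rfl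
  -- The quotient by the support has zero support, so the valuation extends to its fraction field.
  have hsupp : nonZeroDivisors B ≤ wB.supp.primeCompl := by
    intro x hx hx0
    rw [show wB.supp = 0 from Valuation.supp_quot_supp w] at hx0
    exact nonZeroDivisors.ne_zero hx hx0
  let wF : Valuation (FractionRing B) ℝ≥0 := wB.extendToLocalization hsupp _
  have hwF : ∀ b : B, wF (algebraMap B _ b) = wB b :=
    fun b => Valuation.extendToLocalization_apply_map_apply ..
  refine ⟨FractionRing B, inferInstance, absoluteValueOfValuation wF,
    (algebraMap B _).comp (Ideal.Quotient.mk _), fun x y => ?_, fun a => ?_, fun x => ?_,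
    fun M _ ψ hψ => ?_⟩
  · change ((wF (x + y) : ℝ≥0) : ℝ) ≤ max ((wF x : ℝ≥0) : ℝ) (wF y)
    rw [← NNReal.coe_max, NNReal.coe_le_coe]
    exact wF.map_add x y
  · change ((wF _ : ℝ≥0) : ℝ) = _
    rw [RingHom.comp_apply, hwF, hwB, hw]
  · obtain ⟨a, b, hb, rfl⟩ := IsFractionRing.div_surjective (A := B) x
    obtain ⟨a, rfl⟩ := Ideal.Quotient.mk_surjective a
    obtain ⟨b, rfl⟩ := Ideal.Quotient.mk_surjective b
    exact ⟨a, b, IsFractionRing.to_map_ne_zero_of_mem_nonZeroDivisors (R := B) hb, rfl⟩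
  · let g : B →+* M := Ideal.Quotient.lift w.supp ψ fun a ha => (hψ a).2 ((hmem a).1 ha)
    have hg : Function.Injective g := by
      refine (injective_iff_map_eq_zero g).2 fun b hb => ?_
      obtain ⟨a, rfl⟩ := Ideal.Quotient.mk_surjective b
      exact Ideal.Quotient.eq_zero_iff_mem.2 ((hmem a).2 ((hψ a).1 hb))
    refine ⟨IsFractionRing.lift hg, fun a => ?_⟩
    rw [RingHom.comp_apply, IsFractionRing.lift_algebraMap]
    rfl

/-- The completed residue field of a nonzero point of the spectrum. -/
theorem exists_completedResidueField {A : Type u} [CommRing A] {N : SubmulNorm A}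
    (α : GelfandSpectrum N) (h1 : α 1 = 1) :
    ∃ (K : Type u) (_ : NormedField K) (_ : CompleteSpace K) (_ : IsUltrametricDist K)
      (ρ : A →+* K), (∀ a, ‖ρ a‖ = α a) ∧ Dense {x | ∃ a b, ρ b ≠ 0 ∧ x = ρ a / ρ b} ∧
      ∀ (M : Type u) [NormedField M] [CompleteSpace M] (ψ : A →+* M), (∀ a, ‖ψ a‖ = α a) →
        ∃ j : K →+* M, (∀ x, ‖j x‖ = ‖x‖) ∧ ∀ a, j (ρ a) = ψ a := by
  obtain ⟨F, _, v, φ, hv, hφ, hfrac, hlift⟩ := exists_residueField α h1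
  let c : WithAbs v →+* v.Completion := UniformSpace.Completion.coeRingHom
  have hc : ∀ x, ‖c x‖ = v x.ofAbs := fun x => UniformSpace.Completion.norm_coe x
  let c' : F →+* v.Completion := c.comp (WithAbs.equiv v).symm.toRingHom
  have hdense : DenseRange c := UniformSpace.Completion.denseRange_coe
  have hult : IsUltrametricDist v.Completion := by
    refine IsUltrametricDist.isUltrametricDist_of_forall_norm_add_le_max_norm fun x y => ?_
    induction x, y using UniformSpace.Completion.induction_on₂ with
    | hp => exact isClosed_le (by fun_prop) (by fun_prop)
    | ih x y =>
      change ‖c x + c y‖ ≤ max ‖c x‖ ‖c y‖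
      rw [← map_add, hc, hc, hc]
      exact hv _ _
  refine ⟨v.Completion, inferInstance, inferInstance, hult,
    c'.comp φ, fun a => ?_, ?_, fun M _ _ ψ hψ => ?_⟩
  · exact (hc _).trans (hφ a)
  · refine Dense.mono ?_ hdense
    rintro _ ⟨x, rfl⟩
    obtain ⟨a, b, hb, hx⟩ := hfrac x.ofAbs
    refine ⟨a, b, (_root_.map_ne_zero c').2 hb, ?_⟩
    change c' x.ofAbs = c' (φ a) / c' (φ b)
    rw [hx, map_div₀]
  -- The kernel of `ψ` is the zero set of `α`, so `ψ` factors through the fraction field,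
  -- isometrically, and then extends by continuity.
  · obtain ⟨j, hj⟩ := hlift M ψ fun a => by rw [← norm_eq_zero, hψ]
    have hjn : ∀ x, ‖j x‖ = v x := fun x => by
      obtain ⟨a, b, -, rfl⟩ := hfrac x
      rw [map_div₀, map_div₀, hj, hj, norm_div, hψ, hψ, hφ, hφ]
    let j' : WithAbs v →+* M := j.comp (WithAbs.equiv v).toRingHom
    have hj' : Continuous j' :=
      (AddMonoidHomClass.isometry_of_norm j' fun x => hjn x.ofAbs).continuous
    refine ⟨UniformSpace.Completion.extensionHom j' hj', fun x => ?_, fun a => ?_⟩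
    · induction x using UniformSpace.Completion.induction_on with
      | hp =>
        refine isClosed_eq ?_ (by fun_prop)
        exact continuous_norm.comp UniformSpace.Completion.continuous_extension
      | ih x =>
        rw [UniformSpace.Completion.extensionHom_coe, UniformSpace.Completion.norm_coe]
        exact hjn x.ofAbs
    · exact (UniformSpace.Completion.extensionHom_coe j' hj' _).trans (hj a)

end ResidueField

/-! ### Generic points of discs -/

section GaussPoints

variable {E : Type*} [Field E] {w : AbsoluteValue E ℝ}

/-- The value of a polynomial at the generic point of the closed disc of centre `t` and
radius `s`. -/
noncomputable def discNorm (w : AbsoluteValue E ℝ) (t : E) (s : ℝ) (p : E[X]) : ℝ :=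
  (taylor t p).gaussNorm w s

theorem discNorm_C (t c : E) (s : ℝ) : discNorm w t s (C c) = w c := by
  rw [discNorm, taylor_C, gaussNorm_C]

theorem discNorm_mul (hw : IsNonarchimedean w) (t : E) {s : ℝ} (hs : 0 ≤ s) (p q : E[X]) :
    discNorm w t s (p * q) = discNorm w t s p * discNorm w t s q := by
  rw [discNorm, taylor_mul]
  -- Radius `0` degenerates to evaluation at `t`, for which only the constant Taylor coefficient
  -- matters.
  rcases hs.eq_or_lt with rfl | hs
  · simp_rw [discNorm, gaussNorm_zero_right, mul_coeff_zero, map_mul]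
  · exact gaussNorm_mul hw hs _ _

theorem le_discNorm (t : E) {s : ℝ} (hs : 0 ≤ s) (p : E[X]) (i : ℕ) :
    s ^ i * w ((hasseDeriv i p).eval t) ≤ discNorm w t s p := by
  rw [mul_comm, ← taylor_coeff]
  exact le_gaussNorm w _ hs i

theorem exists_eq_discNorm (t : E) (s : ℝ) (p : E[X]) :
    ∃ i, discNorm w t s p = s ^ i * w ((hasseDeriv i p).eval t) := by
  obtain ⟨i, hi⟩ := exists_eq_gaussNorm w s (taylor t p)
  exact ⟨i, by rw [mul_comm, ← taylor_coeff]; exact hi⟩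

theorem discNorm_X_sub_C (t a : E) {s : ℝ} (hs : 0 ≤ s) :
    discNorm w t s (X - C a) = max s (w (t - a)) := by
  have h0 := le_discNorm (w := w) t hs (X - C a) 0
  have h1 := le_discNorm (w := w) t hs (X - C a) 1
  have hd1 : hasseDeriv 1 (X - C a) = 1 := by
    rw [hasseDeriv_one, derivative_X_sub_C]
  simp only [pow_zero, one_mul, hasseDeriv_zero', eval_sub, eval_X, eval_C] at h0
  simp only [pow_one, hd1, eval_one, map_one, mul_one] at h1
  refine le_antisymm ?_ (max_le h1 h0)
  obtain ⟨i, hi⟩ := exists_eq_discNorm (w := w) t s (X - C a)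
  rw [hi]
  match i with
  | 0 => simp
  | 1 => simp
  | i + 2 =>
    rw [map_sub, hasseDeriv_X _ (by omega), hasseDeriv_C _ _ (by omega)]
    simp [hs]

/-- This identifies the products of truncated distances in `IsDistance.prod_eq_prod_max` with values
at a disc point. -/
theorem discNorm_prod_X_sub_C (hw : IsNonarchimedean w) (t : E) {s : ℝ} (hs : 0 ≤ s)
    (m : Multiset E) :
    discNorm w t s (m.map fun a => X - C a).prod = (m.map fun a => max s (w (t - a))).prod := by
  induction m using Multiset.induction_on with
  | empty => simpa using discNorm_C (w := w) t 1 s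
  | cons a m ih =>
    rw [Multiset.map_cons, Multiset.map_cons, Multiset.prod_cons, Multiset.prod_cons,
      discNorm_mul hw t hs, ih, discNorm_X_sub_C t a hs]

end GaussPoints

/-! ### Comparison of two points of the line over a complete field -/

section Fields

variable {K : Type*} [Field K]

/-- Two multiplicative functions on `K[X]` agree if they agree on constants and on monic
irreducible polynomials. -/
theorem eq_of_eq_on_monic_irreducible {F G : K[X] → ℝ} (hF : ∀ p q, F (p * q) = F p * F q)
    (hG : ∀ p q, G (p * q) = G p * G q) (hC : ∀ c, F (C c) = G (C c))
    (hirr : ∀ p, p.Monic → Irreducible p → F p = G p) (p : K[X]) : F p = G p := by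
  induction p using WfDvdMonoid.induction_on_irreducible with
  | zero => rw [← C_0, hC]
  | unit u hu =>
    obtain ⟨c, -, rfl⟩ := isUnit_iff.1 hu
    exact hC c
  | mul a i ha hi ih =>
    have hlc : i.leadingCoeff ≠ 0 := leadingCoeff_ne_zero.2 hi.ne_zero
    have hi' : i = C i.leadingCoeff * (i * C i.leadingCoeff⁻¹) := by
      rw [mul_left_comm, ← C_mul, mul_inv_cancel₀ hlc, C_1, mul_one]
    have hirr' : Irreducible (i * C i.leadingCoeff⁻¹) :=
      (irreducible_mul_isUnit (isUnit_C.2 (IsUnit.mk0 _ (inv_ne_zero hlc)))).2 hi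
    have : F i = G i := by
      rw [hi', hF, hG, hC, hirr _ (monic_mul_leadingCoeff_inv hi.ne_zero) hirr']
    rw [hF, hG, ih, this]

variable {L E : Type*} [Field L] [Algebra K L] [Field E] {v : AbsoluteValue L ℝ}
  {w : AbsoluteValue E ℝ}

theorem isDistance_of_isometric (hw : IsNonarchimedean w) {ι : L →+* E} (hι : ∀ x, w (ι x) = v x)
    (t : E) : IsDistance v fun a => w (t - ι a) where
  nonneg a := w.nonneg _
  le_max a b := by
    rw [← hι, ← w.map_neg (ι (a - b))]
    have : t - ι a = (t - ι b) + -ι (a - b) := by rw [map_sub]; ring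
    rw [this]
    exact hw _ _
  sub_le_max a b := by
    rw [← hι, ← w.map_neg (t - ι a)]
    have : ι (a - b) = -(t - ι a) + (t - ι b) := by rw [map_sub]; ring
    rw [this]
    exact hw _ _

theorem map_minpoly_eq_prod [Normal K L] (ι : L →+* E) (a : L) :
    (minpoly K a).map (ι.comp (algebraMap K L)) =
      (((minpoly K a).aroots L).map fun b => X - C (ι b)).prod := by
  have h := (Normal.splits (F := K) (K := L) inferInstance a).eq_prod_roots_of_monic
    ((minpoly.monic (Normal.isIntegral inferInstance a)).map _)
  rw [← Polynomial.map_map, h, Polynomial.map_multiset_prod, Multiset.map_map]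
  simp [aroots_def]

end Fields

/-- The value of a minimal polynomial at a point `t` is the product of the distances from `t` to its
roots. -/
theorem abs_eval_minpoly {K L E : Type*} [Field K] [Field L] [Algebra K L] [Normal K L] [Field E]
    (w : AbsoluteValue E ℝ) (ι : L →+* E) (t : E) (a : L) :
    w (((minpoly K a).map (ι.comp (algebraMap K L))).eval t) =
      (((minpoly K a).aroots L).map fun b => w (t - ι b)).prod := by
  rw [map_minpoly_eq_prod, eval_multiset_prod, map_multiset_prod, Multiset.map_map,
    Multiset.map_map]
  simp

/-- Comparison of two points of the affine line over a complete field `K`, with coordinates in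
two extensions. -/
theorem abs_eval_eq_discNorm {K L E E' : Type*} [NormedField K] [CompleteSpace K]
    [IsUltrametricDist K] [Field L] [Algebra K L] [IsAlgClosure K L] [Field E] [Field E']
    {v : AbsoluteValue L ℝ} (hv : IsNonarchimedean v) (hvK : ∀ x : K, v (algebraMap K L x) = ‖x‖)
    {w : AbsoluteValue E ℝ} (hw : IsNonarchimedean w) {ι : L →+* E} (hι : ∀ x, w (ι x) = v x)
    {w' : AbsoluteValue E' ℝ} (hw' : IsNonarchimedean w') {ι' : L →+* E'}
    (hι' : ∀ x, w' (ι' x) = v x) {t : E} {t' : E'}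
    (hle : ∀ p : K[X], w' ((p.map (ι'.comp (algebraMap K L))).eval t') ≤
      w ((p.map (ι.comp (algebraMap K L))).eval t)) (p : K[X]) :
    w ((p.map (ι.comp (algebraMap K L))).eval t) =
      discNorm w' t' (⨅ a, w (t - ι a)) (p.map (ι'.comp (algebraMap K L))) := by
  have : Algebra.IsAlgebraic K L := IsAlgClosure.isAlgebraic
  have : IsAlgClosed L := IsAlgClosure.isAlgClosed K
  have : Normal K L := IsAlgClosure.normal K L
  have hs : 0 ≤ ⨅ a, w (t - ι a) := Real.iInf_nonneg fun a => w.nonneg _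
  refine eq_of_eq_on_monic_irreducible
    (F := fun p => w ((p.map (ι.comp (algebraMap K L))).eval t))
    (G := fun p => discNorm w' t' (⨅ a, w (t - ι a)) (p.map (ι'.comp (algebraMap K L))))
    (fun p q => by simp) (fun p q => by simp only [Polynomial.map_mul, discNorm_mul hw' t' hs])
    (fun c => ?_) (fun p hp hirr => ?_) p
  · simp only [map_C, eval_C, discNorm_C, RingHom.comp_apply, hι, hι']
  -- A monic irreducible polynomial is the minimal polynomial of any of its roots, so the comparison
  -- of distance products applies.
  · obtain ⟨a, ha⟩ := IsAlgClosed.exists_aeval_eq_zero L p hirr.degree_pos.ne'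
    obtain rfl := minpoly.eq_of_irreducible_of_monic hirr ha hp
    rw [abs_eval_minpoly, (isDistance_of_isometric hw hι t).prod_eq_prod_max
      (isDistance_of_isometric hw' hι' t') (absoluteValue_algEquiv hv hvK) (fun b => ?_) a,
      map_minpoly_eq_prod ι']
    · have h := discNorm_prod_X_sub_C hw' t' hs (((minpoly K a).aroots L).map ι')
      rw [Multiset.map_map, Multiset.map_map] at h
      exact h.symm
    · have h := hle (minpoly K b)
      rwa [abs_eval_minpoly, abs_eval_minpoly] at h

/-- An inequality between two points of the affine line over `K` may be checked on polynomials
with coefficients in a ring whose fractions are dense in `K`. -/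
theorem norm_eval_le_of_dense {R K M M' : Type*} [CommRing R] [NormedField K] [NormedField M]
    [NormedField M'] {ρ : R →+* K} (hρ : Dense {x | ∃ a b, ρ b ≠ 0 ∧ x = ρ a / ρ b})
    {j : K →+* M} (hj : ∀ x, ‖j x‖ = ‖x‖) {j' : K →+* M'} (hj' : ∀ x, ‖j' x‖ = ‖x‖) {t : M} {t' : M'}
    (h : ∀ f : R[X], ‖((f.map ρ).map j').eval t'‖ ≤ ‖((f.map ρ).map j).eval t‖) (p : K[X]) :
    ‖(p.map j').eval t'‖ ≤ ‖(p.map j).eval t‖ := by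
  classical
  have hjc : Continuous j := (AddMonoidHomClass.isometry_of_norm j hj).continuous
  have hjc' : Continuous j' := (AddMonoidHomClass.isometry_of_norm j' hj').continuous
  let n := p.natDegree + 1
  have key : ∀ x : Fin n → K, ‖∑ i, j' (x i) * t' ^ (i : ℕ)‖ ≤ ‖∑ i, j (x i) * t ^ (i : ℕ)‖ := by
    -- Both sides are continuous in the coefficient vector, so fractions suffice; multiplying by the
    -- common denominator `B` then reduces to `h`.
    have hd : Dense (Set.univ.pi fun _ : Fin n => {x | ∃ a b, ρ b ≠ 0 ∧ x = ρ a / ρ b}) :=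
      dense_pi _ fun _ _ => hρ
    refine fun x => hd.induction (P := fun x : Fin n → K =>
      ‖∑ i, j' (x i) * t' ^ (i : ℕ)‖ ≤ ‖∑ i, j (x i) * t ^ (i : ℕ)‖) (fun x hx => ?_)
      (isClosed_le (by fun_prop) (by fun_prop)) x
    choose a b hb hx using fun i => hx i (Set.mem_univ i)
    let B := ∏ i, b i
    have hB : ρ B ≠ 0 := by
      rw [map_prod]
      exact Finset.prod_ne_zero_iff.2 fun i _ => hb i
    have hBx : ∀ i, ρ (a i * ∏ k ∈ Finset.univ.erase i, b k) = ρ B * x i := fun i => by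
      have : b i * ∏ k ∈ Finset.univ.erase i, b k = B :=
        Finset.mul_prod_erase _ _ (Finset.mem_univ i)
      rw [hx, ← this, map_mul, map_mul]
      field_simp [hb i]
    have h1 := h (∑ i : Fin n, C (a i * ∏ k ∈ Finset.univ.erase i, b k) * X ^ (i : ℕ))
    simp only [Polynomial.map_sum, Polynomial.map_mul, Polynomial.map_pow, map_X, map_C, hBx,
      eval_finsetSum, eval_mul, eval_C, eval_pow, eval_X] at h1
    simp only [map_mul, mul_assoc] at h1
    rw [← Finset.mul_sum, ← Finset.mul_sum, norm_mul, norm_mul, hj, hj'] at h1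
    exact le_of_mul_le_mul_left h1 (norm_pos_iff.2 hB)
  have h3 : (p.map j').eval t' = ∑ i : Fin n, j' (p.coeff i) * t' ^ (i : ℕ) := by
    rw [eval_map, eval₂_eq_sum_range, Finset.sum_range]
  have h4 : (p.map j).eval t = ∑ i : Fin n, j (p.coeff i) * t ^ (i : ℕ) := by
    rw [eval_map, eval₂_eq_sum_range, Finset.sum_range]
  rw [h3, h4]
  exact key fun i => p.coeff i

/-! ### Points above `γ` lie on its path -/

theorem hasseDeriv_map {R S : Type*} [Semiring R] [Semiring S] (g : R →+* S) (i : ℕ) (f : R[X]) :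
    hasseDeriv i (f.map g) = (hasseDeriv i f).map g := by
  ext n
  simp [hasseDeriv_coeff]

/-- A point dominating `γ` in its fibre is of the form `H γ s`. -/
theorem exists_eq_H {R : Type u} [CommRing R] {N : SubmulNorm R} (β γ : GelfandSpectrum (gauss N))
    (hmu : mu β = mu γ) (hle : ∀ f, γ f ≤ β f) : ∃ s, β = H γ s := by
  have hconst : ∀ a, β (C a) = γ (C a) := fun a => DFunLike.congr_fun hmu a
  -- The zero seminorm has no residue field; here `β` and `γ` both vanish and any parameter would
  -- do.
  by_cases h0 : β 1 = 0
  · refine ⟨0, GelfandSpectrum.ext fun f => ?_⟩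
    rw [H_zero, β.eq_zero_of_map_one h0, γ.eq_zero_of_map_one]
    rw [← C_1, ← hconst, C_1, h0]
  have hβ1 : β 1 = 1 := β.map_one_eq ⟨1, h0⟩
  have hγ1 : γ 1 = 1 := by rw [← C_1, ← hconst, C_1, hβ1]
  obtain ⟨K, _, _, _, ρ, hρ, hdense, hext⟩ := exists_completedResidueField (mu β) hβ1
  obtain ⟨M, _, _, _, φ, hφ, -⟩ := exists_completedResidueField β hβ1
  obtain ⟨M', _, _, _, φ', hφ', -⟩ := exists_completedResidueField γ hγ1
  obtain ⟨j, hj, hjρ⟩ := hext M (φ.comp C) fun a => hφ _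
  obtain ⟨j', hj', hjρ'⟩ := hext M' (φ'.comp C) fun a => (hφ' _).trans (hconst a).symm
  obtain ⟨v, hv, hvK⟩ := exists_absoluteValue_extending (K := K) (L := AlgebraicClosure K)
  obtain ⟨w, ι, hw, hwM, hιj, hι⟩ := exists_isometric_extension hv hvK j hj
  obtain ⟨w', ι', hw', hwM', hιj', hι'⟩ := exists_isometric_extension hv hvK j' hj'
  have hβe : ∀ p : K[X], (p.map (ι.comp (algebraMap K _))).eval (algebraMap M _ (φ X)) =
      algebraMap M _ ((p.map j).eval (φ X)) := fun p => by
    rw [show ι.comp (algebraMap K _) = (algebraMap M _).comp j from RingHom.ext hιj,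
      ← Polynomial.map_map, eval_map_apply]
  have hγe : ∀ p : K[X], (p.map (ι'.comp (algebraMap K _))).eval (algebraMap M' _ (φ' X)) =
      algebraMap M' _ ((p.map j').eval (φ' X)) := fun p => by
    rw [show ι'.comp (algebraMap K _) = (algebraMap M' _).comp j' from RingHom.ext hιj',
      ← Polynomial.map_map, eval_map_apply]
  have hβf : ∀ f : R[X], ‖((f.map ρ).map j).eval (φ X)‖ = β f := fun f => by
    rw [Polynomial.map_map, show j.comp ρ = φ.comp C from RingHom.ext hjρ,
      eval_map, ← hom_eval₂, eval₂_C_X, hφ]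
  have hγf : ∀ f : R[X], ‖((f.map ρ).map j').eval (φ' X)‖ = γ f := fun f => by
    rw [Polynomial.map_map, show j'.comp ρ = φ'.comp C from RingHom.ext hjρ',
      eval_map, ← hom_eval₂, eval₂_C_X, hφ']
  have hdom := norm_eval_le_of_dense hdense hj hj' (t := φ X) (t' := φ' X) fun f => by
    rw [hβf, hγf]
    exact hle f
  have hmain := abs_eval_eq_discNorm hv hvK hw hι hw' hι' (t := algebraMap M _ (φ X))
    (t' := algebraMap M' _ (φ' X)) fun p => by
      rw [hβe, hγe, hwM, hwM']
      exact hdom p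
  set s : ℝ := ⨅ a, w (algebraMap M _ (φ X) - ι a) with hs
  have hs0 : 0 ≤ s := Real.iInf_nonneg fun a => w.nonneg _
  -- The infimum is bounded by the distance to `0`, which is `β X`.
  have hs1 : s ≤ 1 := by
    refine (ciInf_le ⟨0, by rintro _ ⟨x, rfl⟩; exact w.nonneg _⟩ 0).trans ?_
    rw [map_zero, sub_zero, hwM, hφ]
    exact β.map_X_le
  refine ⟨⟨s, hs0, hs1⟩, GelfandSpectrum.ext fun f => ?_⟩
  have hβ := hmain (f.map ρ)
  rw [hβe, hwM, hβf] at hβ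
  -- The Taylor coefficients at `t'` have the values `γ (hasseDeriv i f)`, so the disc norm of
  -- radius `s` is the maximum defining `H γ s`.
  have hγ : ∀ i, w' ((hasseDeriv i ((f.map ρ).map (ι'.comp (algebraMap K _)))).eval
      (algebraMap M' _ (φ' X))) = γ (hasseDeriv i f) := fun i => by
    rw [hasseDeriv_map, hasseDeriv_map, hγe, hwM', hγf]
  rw [hβ, H_apply]
  refine le_antisymm ?_ (HFun_le γ hs0 fun i => ?_)
  · obtain ⟨i, hi⟩ := exists_eq_discNorm (w := w') (algebraMap M' _ (φ' X)) s
      ((f.map ρ).map (ι'.comp (algebraMap K _)))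
    rw [hi, hγ]
    exact le_HFun γ hs0 f i
  · rw [← hγ]
    exact le_discNorm _ hs0 _ i

end GelfandTree

theorem theoremT {R : Type*} [CommRing R] (N : GelfandTree.SubmulNorm R) :
    (∀ β γ : GelfandTree.GelfandSpectrum (GelfandTree.gauss N),
      GelfandTree.mu β = GelfandTree.mu γ → GelfandTree.Dominates β γ →
        β = GelfandTree.H γ (GelfandTree.radius β) ∧
        GelfandTree.radius γ ≤ GelfandTree.radius β ∧
        (GelfandTree.radius β = GelfandTree.radius γ ↔ β = γ)) ∧
    (∀ α : GelfandTree.GelfandSpectrum N,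
      GelfandTree.IsTree
        (fun β γ : {δ : GelfandTree.GelfandSpectrum (GelfandTree.gauss N) //
            GelfandTree.mu δ = α} =>
          GelfandTree.Dominates β.1 γ.1)) := by
  refine ⟨fun β γ hmu hdom => ?_, fun α => GelfandTree.isTree_of_eq_H α GelfandTree.exists_eq_H⟩
  have hle := (GelfandTree.dominates_iff_le β γ).1 hdom
  obtain ⟨s, hs⟩ := GelfandTree.exists_eq_H β γ hmu hle
  have hr := GelfandTree.eq_H_radius hle hs
  exact ⟨hr, GelfandTree.radius_le_radius hs, GelfandTree.radius_eq_iff hr⟩
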